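/- Let $0<\theta<\pi/4$ and let $c_1\ge c_2>0$ with $c_1+c_2=1$. Alice holds the qubits $A,A'$ and Bob holds the qubits $B,B'$. Put $$|\psi(\theta)\rangle_{AB}=\cos\theta\,|00\rangle+\sin\theta\,|11\rangle,\qquad |\Phi^+\rangle_{AB}=\tfrac{1}{\sqrt2}(|00\rangle+|11\rangle),\qquad |C\rangle_{A'B'}=\sqrt{c_1}\,|00\rangle+\sqrt{c_2}\,|11\rangle,$$ $$|\Psi_{\rm in}\rangle=|\psi(\theta)\rangle_{AB}\otimes|C\rangle_{A'B'},\qquad |\Psi_{\rm out}\rangle=|\Phi^+\rangle_{AB}\otimes|C\rangle_{A'B'}.$$ An LOCC protocol between Alice ($AA'$) and Bob ($BB'$) consists of finitely many rounds; in each round one party performs a local measurement with finitely many outcomes (local ancillas, unitaries and discarding of subsystems are allowed) and announces the outcome, on which all later steps may depend. Then: 1. No LOCC protocol converts $|\Psi_{\rm in}\rangle$ to $|\Psi_{\rm out}\rangle$ with certainty; that is, deterministic catalytic conversion of $|\psi(\theta)\rangle$ to a Bell pair with catalyst $|C\rangle$ is impossible. 2. Consider LOCC protocols that announce success or failure and whose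 final state, given success, is exactly $|\Psi_{\rm out}\rangle$. The maximal probability of success, starting from $|\Psi_{\rm in}\rangle$, exists and equals $$P_{\max}=2\sin^2\theta.$$ 3. This maximum is attained by a one-sided (Procrustean) filter on Alice's qubit $A$ alone. With $M=\mathrm{diag}(\tan\theta,1)$ on $A$, $$(M_A\otimes I_{A'}\otimes I_{BB'})\,|\Psi_{\rm in}\rangle=\sqrt2\,\sin\theta\;|\Phi^+\rangle_{AB}\otimes|C\rangle_{A'B'},$$ and there is an operator $N$ on $A$ with $M^\dagger M+N^\dagger N=I$, such that the protocol in which Alice measures $A$ with Kraus operators $M$ (success) and $N$ (failure), does not touch $A'$, and Bob does nothing, converts $|\Psi_{\rm in}\rangle$ to $|\Psi_{\rm out}\rangle$ with success probability $2\sin^2\theta$. In particular, the catalyst is returned unchanged. -/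

import Mathlib

open scoped Kronecker

/-- The operator `|ψ⟩⟨ψ|` of a state vector `ψ`. -/
def ketbra {X : Type} (ψ : X → ℂ) : Matrix X X ℂ :=
  Matrix.vecMulVec ψ (star ψ)

/-- `a |00⟩ + b |11⟩`, a vector of a pair of qubits. -/
noncomputable def diagPair (a b : ℝ) : Fin 2 × Fin 2 → ℂ :=
  (a : ℂ) • Pi.single (0, 0) 1 + (b : ℂ) • Pi.single (1, 1) 1

/-- The imperfect link `|ψ(θ)⟩ = cos θ |00⟩ + sin θ |11⟩` on `AB`. -/
noncomputable def linkState (θ : ℝ) : Fin 2 × Fin 2 → ℂ :=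
  diagPair (Real.cos θ) (Real.sin θ)

/-- The Bell state `|Φ⁺⟩ = (|00⟩ + |11⟩) / √2` on `AB`. -/
noncomputable def bellState : Fin 2 × Fin 2 → ℂ :=
  diagPair (1 / √2) (1 / √2)

/-- The catalyst `|C⟩ = √c₁ |00⟩ + √c₂ |11⟩` on `A'B'`. -/
noncomputable def catalyst (c₁ c₂ : ℝ) : Fin 2 × Fin 2 → ℂ :=
  diagPair (√c₁) (√c₂)

/-- The product `ψ_{AB} ⊗ χ_{A'B'}`, with the registers sorted by owner:
Alice holds `A × A'` and Bob holds `B × B'`. -/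
def shared {A B A' B' : Type} (ψ : A × B → ℂ) (χ : A' × B' → ℂ) :
    (A × A') × (B × B') → ℂ :=
  fun x => ψ (x.1.1, x.2.1) * χ (x.1.2, x.2.2)

/-- Finite LOCC protocols that start from a system with local computational bases `A` (Alice) and
`B` (Bob), end in a system with local bases `A'`, `B'`, and leave a classical record in `Ω`.

A protocol is a finite tree. In each step one of the parties performs a measurement, given by Kraus
operators `K i` with `∑ i, (K i)ᴴ * K i = 1`, and announces the outcome `i`, on which everything
that follows may depend. The Kraus operators may change the local space, so that
adding local ancillas, local unitaries and channels, and discarding subsystems are included. -/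
inductive LOCC (Ω A' B' : Type) : Type → Type → Type 1
  | done (ω : Ω) : LOCC Ω A' B' A' B'
  | alice {A B : Type} [Fintype A] [DecidableEq A] [Fintype B] [DecidableEq B]
      {ι : Type} [Fintype ι] {X : ι → Type} [∀ i, Fintype (X i)]
      (K : ∀ i, Matrix (X i) A ℂ) (hK : ∑ i, (K i).conjTranspose * K i = 1)
      (next : ∀ i, LOCC Ω A' B' (X i) B) : LOCC Ω A' B' A B
  | bob {A B : Type} [Fintype A] [DecidableEq A] [Fintype B] [DecidableEq B]
      {ι : Type} [Fintype ι] {X : ι → Type} [∀ i, Fintype (X i)]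
      (K : ∀ i, Matrix (X i) B ℂ) (hK : ∑ i, (K i).conjTranspose * K i = 1)
      (next : ∀ i, LOCC Ω A' B' A (X i)) : LOCC Ω A' B' A B

open Classical in
/-- The quantum instrument of a protocol: `P.output ω ρ` is the unnormalized final state on the
event that the final record is `ω`, when the initial state is `ρ`. Its trace is the probability
of that event. -/
noncomputable def LOCC.output {Ω A' B' : Type} {A B : Type} (P : LOCC Ω A' B' A B) (ω : Ω) :
    Matrix (A × B) (A × B) ℂ → Matrix (A' × B') (A' × B') ℂ :=
  match P with
  | .done ω' => fun ρ => if ω' = ω then ρ else 0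
  | @LOCC.alice _ _ _ _ B _ _ _ _ _ _ _ _ K _ next => fun ρ =>
      ∑ i, (next i).output ω
        ((K i ⊗ₖ (1 : Matrix B B ℂ)) * ρ * (K i ⊗ₖ (1 : Matrix B B ℂ)).conjTranspose)
  | @LOCC.bob _ _ _ A _ _ _ _ _ _ _ _ _ K _ next => fun ρ =>
      ∑ i, (next i).output ω
        (((1 : Matrix A A ℂ) ⊗ₖ K i) * ρ * ((1 : Matrix A A ℂ) ⊗ₖ K i).conjTranspose)

/-- Some LOCC protocol (with a trivial record) takes `ψ` to `φ` with certainty. -/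
def DeterministicLOCC {A B A' B' : Type} (ψ : A × B → ℂ) (φ : A' × B' → ℂ) : Prop :=
  ∃ P : LOCC Unit A' B' A B, P.output () (ketbra ψ) = ketbra φ

/-- The protocol `P`, started in `ψ`, announces success (record `true`) with probability `p`,
and then its final state is exactly `φ` (a unit vector). -/
def LOCC.SucceedsWith {A B A' B' : Type} (P : LOCC Bool A' B' A B)
    (ψ : A × B → ℂ) (φ : A' × B' → ℂ) (p : ℝ) : Prop :=
  P.output true (ketbra ψ) = (p : ℂ) • ketbra φ

/-- The success probabilities with which LOCC protocols convert `ψ` to `φ`. -/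
def successProbabilities {A B A' B' : Type} (ψ : A × B → ℂ) (φ : A' × B' → ℂ) : Set ℝ :=
  {p | ∃ P : LOCC Bool A' B' A B, P.SucceedsWith ψ φ p}

/-- The success operator `diag(tan θ, 1)` of the Procrustean filter, acting on the qubit `A`. -/
noncomputable def procrusteanFilter (θ : ℝ) : Matrix (Fin 2) (Fin 2) ℂ :=
  !![(Real.tan θ : ℂ), 0; 0, 1]

theorem filter_complete {A A' : Type} [Fintype A] [DecidableEq A] [Fintype A'] [DecidableEq A']
    (M N : Matrix A A ℂ) (h : M.conjTranspose * M + N.conjTranspose * N = 1) :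
    ∑ s : Bool, ((bif s then M else N) ⊗ₖ (1 : Matrix A' A' ℂ)).conjTranspose *
      ((bif s then M else N) ⊗ₖ (1 : Matrix A' A' ℂ)) = 1 := by
  simp only [Fintype.sum_bool, cond_true, cond_false, Matrix.conjTranspose_kronecker,
    ← Matrix.mul_kronecker_mul, Matrix.conjTranspose_one, mul_one]
  rw [← Matrix.add_kronecker, h, Matrix.one_kronecker_one]

/-- The one-sided filter: Alice measures `A` alone, with Kraus operators `M` (success) and `N`
(failure), leaving `A'` untouched; she announces the outcome, and Bob does nothing. -/
def oneSidedFilter {A A' B : Type} [Fintype A] [DecidableEq A] [Fintype A'] [DecidableEq A']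
    [Fintype B] [DecidableEq B] (M N : Matrix A A ℂ)
    (h : M.conjTranspose * M + N.conjTranspose * N = 1) : LOCC Bool (A × A') B (A × A') B :=
  .alice (ι := Bool) (X := fun _ => A × A')
    (fun s => (bif s then M else N) ⊗ₖ (1 : Matrix A' A' ℂ)) (filter_complete M N h)
    (fun s => .done s)

/-! The upper bound is a rank-approximation form of Vidal's monotone given by the smallest Schmidt
weight. Run the protocol on the input and, in parallel, on the input with its `|11⟩|11⟩` term
deleted. Local operators never raise Schmidt rank, and complete measurements preserve total squared
norm, so the branches acquire rank-3 approximations with total squared error at most `sin²θ · c₂`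
(`LOCC.exists_branches`). Each success branch is a multiple of the target
(`proportional_of_sum_ketbra`), which has rank 4 and least squared Schmidt coefficient `c₂ / 2`, so
a branch of weight `q` costs error at least `q c₂ / 2` (`le_sqNorm_sub_of_schmidtRankLE`). Summing,
`p c₂ / 2 ≤ sin²θ · c₂`: the catalyst cancels. The filter attains the bound, and `2 sin²θ < 1`
excludes certainty. -/

theorem mul_ketbra_mul_conjTranspose {X Y : Type} [Fintype X] (L : Matrix Y X ℂ) (v : X → ℂ) :
    L * ketbra v * L.conjTranspose = ketbra (L.mulVec v) := by
  rw [ketbra, ketbra, Matrix.mul_vecMulVec, Matrix.vecMulVec_mul, Matrix.star_mulVec]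

/-! ### Norm and Schmidt rank along a protocol. -/

/-- The squared Euclidean norm of a state vector. -/
def sqNorm {X : Type} [Fintype X] (v : X → ℂ) : ℝ := ∑ x, Complex.normSq (v x)

theorem sqNorm_nonneg {X : Type} [Fintype X] (v : X → ℂ) : 0 ≤ sqNorm v :=
  Finset.sum_nonneg fun _ _ => Complex.normSq_nonneg _

theorem ofReal_sqNorm {X : Type} [Fintype X] (v : X → ℂ) :
    (sqNorm v : ℂ) = star v ⬝ᵥ v := by
  simp [sqNorm, dotProduct, Complex.normSq_eq_conj_mul_self]

/-- The outcomes of a complete measurement have total probability one. -/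
theorem sum_sqNorm_mulVec {X ι : Type} [Fintype X] [DecidableEq X] [Fintype ι] {Y : ι → Type}
    [∀ i, Fintype (Y i)] (L : ∀ i, Matrix (Y i) X ℂ)
    (hL : ∑ i, (L i).conjTranspose * L i = 1) (v : X → ℂ) :
    ∑ i, sqNorm ((L i).mulVec v) = sqNorm v := by
  have h : ((∑ i, sqNorm ((L i).mulVec v) : ℝ) : ℂ) = (sqNorm v : ℂ) := by
    push_cast
    simp_rw [ofReal_sqNorm, Matrix.star_mulVec, ← Matrix.dotProduct_mulVec, Matrix.mulVec_mulVec]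
    rw [← dotProduct_sum, ← Matrix.sum_mulVec, hL, Matrix.one_mulVec]
  exact_mod_cast h

/-- The Schmidt rank of `w` is at most `r`. -/
def SchmidtRankLE {A B : Type} (r : ℕ) (w : A × B → ℂ) : Prop :=
  ∃ (a : Fin r → A → ℂ) (b : Fin r → B → ℂ), ∀ x y, w (x, y) = ∑ j, a j x * b j y

/-- A product operator sends product vectors to product vectors, so it acts on a decomposition term
by term. -/
theorem SchmidtRankLE.kronecker_mulVec {A B X Y : Type} [Fintype A] [Fintype B] {r : ℕ}
    {w : A × B → ℂ} (hw : SchmidtRankLE r w) (K : Matrix X A ℂ) (L : Matrix Y B ℂ) :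
    SchmidtRankLE r ((K ⊗ₖ L).mulVec w) := by
  obtain ⟨a, b, h⟩ := hw
  refine ⟨fun j => K.mulVec (a j), fun j => L.mulVec (b j), fun x y => ?_⟩
  simp only [Matrix.mulVec, dotProduct, Fintype.sum_prod_type, h, Matrix.kroneckerMap_apply,
    Finset.mul_sum, Finset.sum_mul]
  rw [Finset.sum_comm_cycle]
  refine Finset.sum_congr rfl fun j _ => ?_
  rw [Finset.sum_comm]
  refine Finset.sum_congr rfl fun _ _ => Finset.sum_congr rfl fun _ _ => by ring

/-- On a pure state an LOCC protocol acts by branches; a low Schmidt rank approximation of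
the state yields approximations of the branches, with no larger total squared error. -/
theorem LOCC.exists_branches {Ω A' B' : Type} [iA' : Fintype A'] [iB' : Fintype B'] (ω : Ω) (r : ℕ)
    {A B : Type} (P : LOCC Ω A' B' A B) :
    ∀ [Fintype A] [Fintype B] (v w : A × B → ℂ), SchmidtRankLE r w →
      ∃ (κ : Type) (_ : Fintype κ) (v' w' : κ → A' × B' → ℂ),
        P.output ω (ketbra v) = ∑ k, ketbra (v' k) ∧ (∀ k, SchmidtRankLE r (w' k)) ∧
        ∑ k, sqNorm (v' k - w' k) ≤ sqNorm (v - w) := by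
  induction P with
  | done ω' =>
    intro fA fB v w hw
    obtain rfl := Subsingleton.elim fA iA'
    obtain rfl := Subsingleton.elim fB iB'
    by_cases h : ω' = ω
    · exact ⟨Unit, inferInstance, fun _ => v, fun _ => w, by simp [LOCC.output, h],
        fun _ => hw, by simp⟩
    -- A leaf with another record contributes no branch; its error is discarded, hence only an
    -- inequality.
    · refine ⟨Empty, inferInstance, fun _ => v, fun _ => w, by simp [LOCC.output, h],
        fun _ => hw, ?_⟩
      simpa using sqNorm_nonneg (v - w)
  | @alice A B iA _ iB _ ι _ X _ K hK next ih =>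
    intro fA fB v w hw
    obtain rfl := Subsingleton.elim iA fA
    obtain rfl := Subsingleton.elim iB fB
    choose κ fκ v' w' hout hrank herr using fun i =>
      ih i ((K i ⊗ₖ (1 : Matrix B B ℂ)).mulVec v) ((K i ⊗ₖ (1 : Matrix B B ℂ)).mulVec w)
        (hw.kronecker_mulVec _ _)
    refine ⟨Σ i, κ i, inferInstance, fun k => v' k.1 k.2, fun k => w' k.1 k.2, ?_,
      fun k => hrank _ _, ?_⟩
    · simp only [LOCC.output, mul_ketbra_mul_conjTranspose, hout, Fintype.sum_sigma]
    · rw [Fintype.sum_sigma, ← sum_sqNorm_mulVec (fun i => K i ⊗ₖ (1 : Matrix B B ℂ)) ?_ (v - w)]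
      · refine Finset.sum_le_sum fun i _ => ?_
        simpa only [Matrix.mulVec_sub] using herr i
      · simp only [Matrix.conjTranspose_kronecker, ← Matrix.mul_kronecker_mul,
          Matrix.conjTranspose_one, mul_one]
        rw [← Matrix.one_kronecker_one, ← hK]
        ext ⟨a, b⟩ ⟨a', b'⟩
        simp [Matrix.sum_apply, Finset.sum_mul]
  | @bob A B iA _ iB _ ι _ X _ K hK next ih =>
    intro fA fB v w hw
    obtain rfl := Subsingleton.elim iA fA
    obtain rfl := Subsingleton.elim iB fB
    choose κ fκ v' w' hout hrank herr using fun i =>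
      ih i (((1 : Matrix A A ℂ) ⊗ₖ K i).mulVec v) (((1 : Matrix A A ℂ) ⊗ₖ K i).mulVec w)
        (hw.kronecker_mulVec _ _)
    refine ⟨Σ i, κ i, inferInstance, fun k => v' k.1 k.2, fun k => w' k.1 k.2, ?_,
      fun k => hrank _ _, ?_⟩
    · simp only [LOCC.output, mul_ketbra_mul_conjTranspose, hout, Fintype.sum_sigma]
    · rw [Fintype.sum_sigma, ← sum_sqNorm_mulVec (fun i => (1 : Matrix A A ℂ) ⊗ₖ K i) ?_ (v - w)]
      · refine Finset.sum_le_sum fun i _ => ?_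
        simpa only [Matrix.mulVec_sub] using herr i
      · simp only [Matrix.conjTranspose_kronecker, ← Matrix.mul_kronecker_mul,
          Matrix.conjTranspose_one, mul_one]
        rw [← Matrix.one_kronecker_one, ← hK]
        ext ⟨a, b⟩ ⟨a', b'⟩
        simp [Matrix.sum_apply, Finset.mul_sum]

/-! ### Bounds for a pure diagonal target. -/

/-- If a mixture of pure states is pure, then all of them are proportional to it. -/
theorem proportional_of_sum_ketbra {X κ : Type} [Fintype κ] (v : κ → X → ℂ) (φ : X → ℂ) (p : ℂ)
    (h : ∑ k, ketbra (v k) = p • ketbra φ) (x y : X) (k : κ) : φ y * v k x = φ x * v k y := by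
  have hent : ∀ a b, ∑ k, v k a * star (v k b) = p * (φ a * star (φ b)) := fun a b => by
    simpa [ketbra, Matrix.sum_apply, Matrix.vecMulVec_apply] using congrFun (congrFun h a) b
  -- The squared 2×2 minors, summed over `k`, involve only entries of the mixture, and these cancel
  -- for a multiple of `ketbra φ`.
  have hsum : ((∑ k, Complex.normSq (φ y * v k x - φ x * v k y) : ℝ) : ℂ) = 0 := by
    push_cast
    have : ∀ k, (Complex.normSq (φ y * v k x - φ x * v k y) : ℂ) =
        φ y * star (φ y) * (v k x * star (v k x)) - φ y * star (φ x) * (v k x * star (v k y))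
        - φ x * star (φ y) * (v k y * star (v k x)) + φ x * star (φ x) * (v k y * star (v k y)) :=
      fun k => by
        rw [← Complex.mul_conj]
        simp only [map_sub, map_mul, starRingEnd_apply]
        ring
    simp_rw [this, Finset.sum_add_distrib, Finset.sum_sub_distrib, ← Finset.mul_sum, hent]
    ring
  have h0 := (Finset.sum_eq_zero_iff_of_nonneg fun k _ => Complex.normSq_nonneg _).1
    (Complex.ofReal_eq_zero.1 hsum) k (Finset.mem_univ k)
  exact sub_eq_zero.1 (Complex.normSq_eq_zero.1 h0)

/-- The squared distance from a diagonal vector to the vectors of smaller Schmidt rank is at least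
the least squared Schmidt coefficient. -/
theorem le_sqNorm_sub_of_schmidtRankLE {X : Type} [Fintype X] [DecidableEq X] {r : ℕ}
    (hr : r < Fintype.card X) (v w : X × X → ℂ) (hv : ∀ x y, x ≠ y → v (x, y) = 0)
    (hw : SchmidtRankLE r w) (m : ℝ) (hm : ∀ x, m ≤ Complex.normSq (v (x, x))) :
    m ≤ sqNorm (v - w) := by
  obtain ⟨a, b, hab⟩ := hw
  -- A test vector killed by all `r` Bob factors of `w`: on it `v - w` acts like the diagonal `v`,
  -- and Cauchy–Schwarz in each row bounds the error below.
  obtain ⟨u, hu, hu0⟩ : ∃ u : X → ℂ, u ≠ 0 ∧ (Matrix.of b).mulVec u = 0 := by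
    obtain ⟨u, hu0, hu⟩ := Submodule.exists_mem_ne_zero_of_ne_bot
      (LinearMap.ker_ne_bot_of_finrank_lt (f := (Matrix.of b).mulVecLin) (by simpa using hr))
    exact ⟨u, hu, hu0⟩
  have hwu : ∀ x, ∑ y, w (x, y) * u y = 0 := fun x => by
    simp_rw [hab, Finset.sum_mul]
    rw [Finset.sum_comm]
    refine Finset.sum_eq_zero fun j _ => ?_
    have := congrFun hu0 j
    simp only [Matrix.mulVec, dotProduct, Matrix.of_apply, Pi.zero_apply] at this
    simp_rw [mul_assoc]
    rw [← Finset.mul_sum, this, mul_zero]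
  have hvu : ∀ x, ∑ y, (v - w) (x, y) * u y = v (x, x) * u x := fun x => by
    simp only [Pi.sub_apply, sub_mul, Finset.sum_sub_distrib, hwu, sub_zero]
    exact Finset.sum_eq_single x (fun y _ hy => by rw [hv x y hy.symm, zero_mul]) (by simp)
  have hpos : 0 < sqNorm u := by
    obtain ⟨x, hx⟩ := Function.ne_iff.1 hu
    exact Finset.sum_pos' (fun x _ => Complex.normSq_nonneg _)
      ⟨x, Finset.mem_univ x, Complex.normSq_pos.2 hx⟩
  have hcs : ∀ x, Complex.normSq (v (x, x) * u x) ≤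
      (∑ y, Complex.normSq ((v - w) (x, y))) * sqNorm u := fun x => by
    rw [← hvu]
    simp only [sqNorm, Complex.normSq_eq_norm_sq]
    calc _ ≤ (∑ y, ‖(v - w) (x, y)‖ * ‖u y‖) ^ 2 := by
          gcongr
          exact (norm_sum_le _ _).trans_eq (by simp_rw [norm_mul])
      _ ≤ _ := Finset.sum_mul_sq_le_sq_mul_sq _ _ _
  refine le_of_mul_le_mul_right ?_ hpos
  calc m * sqNorm u = ∑ x, m * Complex.normSq (u x) := by rw [sqNorm, Finset.mul_sum]
    _ ≤ ∑ x, Complex.normSq (v (x, x) * u x) := Finset.sum_le_sum fun x _ => by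
        rw [Complex.normSq_mul]
        exact mul_le_mul_of_nonneg_right (hm x) (Complex.normSq_nonneg _)
    _ ≤ ∑ x, (∑ y, Complex.normSq ((v - w) (x, y))) * sqNorm u :=
        Finset.sum_le_sum fun x _ => hcs x
    _ = sqNorm (v - w) * sqNorm u := by
        rw [← Finset.sum_mul, sqNorm.eq_def (v - w), Fintype.sum_prod_type]

/-- A bound on the conversion probability to a diagonal state, from a low Schmidt rank
approximation of the initial state. -/
theorem LOCC.probability_mul_le {Ω A B X : Type} [Fintype A] [Fintype B] [Fintype X]
    [DecidableEq X] (P : LOCC Ω X X A B) (ω : Ω) {r : ℕ} (hr : r < Fintype.card X)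
    (ψ w : A × B → ℂ) (hw : SchmidtRankLE r w) (φ : X × X → ℂ)
    (hφ : ∀ x y, x ≠ y → φ (x, y) = 0) (m p : ℝ) (hm₀ : 0 < m)
    (hm : ∀ x, m ≤ Complex.normSq (φ (x, x)))
    (h : P.output ω (ketbra ψ) = (p : ℂ) • ketbra φ) : p * m ≤ sqNorm (ψ - w) := by
  obtain ⟨κ, _, v', w', hout, hrank, herr⟩ := P.exists_branches ω r ψ w hw
  have hsum := hout.symm.trans h
  obtain ⟨x₀⟩ : Nonempty X := Fintype.card_pos_iff.1 (by omega)
  have h0 : 0 < Complex.normSq (φ (x₀, x₀)) := hm₀.trans_le (hm x₀)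
  have hne : φ (x₀, x₀) ≠ 0 := Complex.normSq_pos.1 h0
  have hprop : ∀ k x, v' k x = v' k (x₀, x₀) / φ (x₀, x₀) * φ x := fun k x => by
    have := proportional_of_sum_ketbra v' φ p hsum x (x₀, x₀) k
    field_simp
    linear_combination this
  -- The branch weights are read off from one diagonal entry, nonzero since `0 < m`.
  have hp : ∑ k, Complex.normSq (v' k (x₀, x₀) / φ (x₀, x₀)) = p := by
    have hent : ((∑ k, Complex.normSq (v' k (x₀, x₀)) : ℝ) : ℂ) =
        ((p * Complex.normSq (φ (x₀, x₀)) : ℝ) : ℂ) := by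
      simpa [ketbra, Matrix.sum_apply, Matrix.vecMulVec_apply, Complex.mul_conj] using
        congrFun (congrFun hsum (x₀, x₀)) (x₀, x₀)
    simp_rw [Complex.normSq_div]
    rw [← Finset.sum_div, Complex.ofReal_injective hent, mul_div_cancel_right₀ _ h0.ne']
  refine le_trans ?_ herr
  rw [← hp, Finset.sum_mul]
  refine Finset.sum_le_sum fun k _ => ?_
  refine le_sqNorm_sub_of_schmidtRankLE hr _ _ (fun x y hxy => ?_) (hrank k) _ fun x => ?_
  · rw [hprop, hφ x y hxy, mul_zero]
  · rw [hprop k (x, x), Complex.normSq_mul]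
    exact mul_le_mul_of_nonneg_left (hm x) (Complex.normSq_nonneg _)

/-! ### The two-qubit-pair states and the optimal bound. -/

theorem shared_diagPair_apply (a b c d : ℝ) (x y : Fin 2 × Fin 2) :
    shared (diagPair a b) (diagPair c d) (x, y) =
      if x = y then ((if x.1 = 0 then a else b : ℝ) : ℂ) * ((if x.2 = 0 then c else d : ℝ) : ℂ)
      else 0 := by
  obtain ⟨x₁, x₂⟩ := x
  obtain ⟨y₁, y₂⟩ := y
  fin_cases x₁ <;> fin_cases x₂ <;> fin_cases y₁ <;> fin_cases y₂ <;>
    simp [shared, diagPair]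

/-- The vector `∑ x ≠ (1, 1), f x |xx⟩` has Schmidt rank at most three. -/
theorem schmidtRankLE_three (f : Fin 2 × Fin 2 → ℂ) :
    SchmidtRankLE 3 (fun z : (Fin 2 × Fin 2) × (Fin 2 × Fin 2) =>
      if z.1 = z.2 ∧ z.1 ≠ (1, 1) then f z.1 else 0) := by
  refine ⟨fun j => Pi.single (![(0, 0), (0, 1), (1, 0)] j) (f (![(0, 0), (0, 1), (1, 0)] j)),
    fun j => Pi.single (![(0, 0), (0, 1), (1, 0)] j) 1, ?_⟩
  rintro ⟨x₁, x₂⟩ ⟨y₁, y₂⟩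
  fin_cases x₁ <;> fin_cases x₂ <;> fin_cases y₁ <;> fin_cases y₂ <;>
    simp [Fin.sum_univ_three, Pi.single_apply]

/-- No LOCC protocol beats the filter, whatever it records. -/
theorem LOCC.probability_le {Ω : Type} (θ c₁ c₂ : ℝ) (hc : c₂ ≤ c₁) (hc₂ : 0 < c₂)
    (P : LOCC Ω (Fin 2 × Fin 2) (Fin 2 × Fin 2) (Fin 2 × Fin 2) (Fin 2 × Fin 2)) (ω : Ω) (p : ℝ)
    (h : P.output ω (ketbra (shared (linkState θ) (catalyst c₁ c₂))) =
      (p : ℂ) • ketbra (shared bellState (catalyst c₁ c₂))) : p ≤ 2 * Real.sin θ ^ 2 := by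
  have hc₁ : 0 < c₁ := hc₂.trans_le hc
  -- The target's squared Schmidt coefficients are `c₁ / 2` and `c₂ / 2`, so `c₂ ≤ c₁` makes `m = c₂
  -- / 2` admissible.
  have key := P.probability_mul_le ω (r := 3) (by simp) _ _
    (schmidtRankLE_three fun x => shared (linkState θ) (catalyst c₁ c₂) (x, x)) _
    (fun x y hxy => by rw [bellState, catalyst, shared_diagPair_apply, if_neg hxy])
    (c₂ / 2) p (by positivity) (fun x => ?_) h
  · have hδ : sqNorm (shared (linkState θ) (catalyst c₁ c₂) -
        fun z => if z.1 = z.2 ∧ z.1 ≠ (1, 1) then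
          shared (linkState θ) (catalyst c₁ c₂) (z.1, z.1) else 0) = Real.sin θ ^ 2 * c₂ := by
      simp only [sqNorm, Fintype.sum_prod_type, Fin.sum_univ_two, Pi.sub_apply, linkState,
        catalyst, shared_diagPair_apply]
      simp [Complex.normSq_ofReal, -Complex.ofReal_sin, Real.mul_self_sqrt hc₂.le]
      exact Or.inl (sq _).symm
    rw [hδ] at key
    refine le_of_mul_le_mul_right ?_ hc₂
    linarith
  · rw [bellState, catalyst, shared_diagPair_apply, if_pos rfl, Complex.normSq_mul,
      Complex.normSq_ofReal, Complex.normSq_ofReal]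
    have h2 : (1 / √2) * (1 / √2) = (1 / 2 : ℝ) := by
      rw [div_mul_div_comm, Real.mul_self_sqrt (by norm_num), one_mul]
    split_ifs <;> simp only [h2, Real.mul_self_sqrt hc₁.le, Real.mul_self_sqrt hc₂.le] <;> linarith

/-! ### Attainment by the filter. -/

theorem procrusteanFilter_mulVec (θ c₁ c₂ : ℝ) (hcos : Real.cos θ ≠ 0) :
    ((procrusteanFilter θ ⊗ₖ (1 : Matrix (Fin 2) (Fin 2) ℂ)) ⊗ₖ
        (1 : Matrix (Fin 2 × Fin 2) (Fin 2 × Fin 2) ℂ)).mulVec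
          (shared (linkState θ) (catalyst c₁ c₂)) =
      ((√2 * Real.sin θ : ℝ) : ℂ) • shared bellState (catalyst c₁ c₂) := by
  have h2 : (√2 : ℂ) ≠ 0 := by simp
  have ht : (Real.tan θ : ℂ) * (Real.cos θ : ℂ) = (Real.sin θ : ℂ) := by
    rw [← Complex.ofReal_mul, Real.tan_mul_cos hcos]
  ext ⟨x, y⟩
  simp only [Matrix.mulVec, dotProduct, Fintype.sum_prod_type (α₁ := Fin 2 × Fin 2),
    linkState, bellState, catalyst, Pi.smul_apply, shared_diagPair_apply, mul_ite, mul_zero,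
    Finset.sum_ite_eq, Finset.mem_univ, if_true]
  obtain ⟨x₁, x₂⟩ := x
  obtain ⟨y₁, y₂⟩ := y
  fin_cases x₁ <;> fin_cases x₂ <;> fin_cases y₁ <;> fin_cases y₂ <;>
    simp [procrusteanFilter, Matrix.one_apply, ← mul_assoc,
      -Complex.ofReal_sin, -Complex.ofReal_cos, -Complex.ofReal_tan, ht]
    <;> (left; field_simp)

theorem oneSidedFilter_succeedsWith {A A' B : Type} [Fintype A] [DecidableEq A] [Fintype A']
    [DecidableEq A'] [Fintype B] [DecidableEq B] (M N : Matrix A A ℂ)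
    (h : M.conjTranspose * M + N.conjTranspose * N = 1) (ψ φ : (A × A') × B → ℂ) (s : ℝ)
    (hs : ((M ⊗ₖ (1 : Matrix A' A' ℂ)) ⊗ₖ (1 : Matrix B B ℂ)).mulVec ψ = (s : ℂ) • φ) :
    (oneSidedFilter M N h).SucceedsWith ψ φ (s ^ 2) := by
  rw [LOCC.SucceedsWith]
  simp only [oneSidedFilter, LOCC.output, Fintype.sum_bool, cond_true, if_true,
    mul_ketbra_mul_conjTranspose, hs]
  ext x y
  simp [ketbra, Matrix.vecMulVec_apply]
  ring

theorem exists_failure_operator (θ : ℝ) (h : Real.tan θ ^ 2 ≤ 1) :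
    ∃ N : Matrix (Fin 2) (Fin 2) ℂ,
      (procrusteanFilter θ).conjTranspose * procrusteanFilter θ + N.conjTranspose * N = 1 := by
  refine ⟨!![((√(1 - Real.tan θ ^ 2) : ℝ) : ℂ), 0; 0, 0], ?_⟩
  have hN : ((√(1 - Real.tan θ ^ 2) : ℝ) : ℂ) * ((√(1 - Real.tan θ ^ 2) : ℝ) : ℂ) =
      1 - (Real.tan θ : ℂ) * (Real.tan θ : ℂ) := by
    rw [← Complex.ofReal_mul, Real.mul_self_sqrt (by linarith)]
    push_cast
    ring
  ext i j
  fin_cases i <;> fin_cases j <;>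
    simp [procrusteanFilter, Matrix.mul_apply, Fin.sum_univ_two, -Complex.ofReal_tan, hN]

theorem mainTheorem10 (θ c₁ c₂ : ℝ) (hθ₀ : 0 < θ) (hθ : θ < Real.pi / 4)
    (hc : c₂ ≤ c₁) (hc₂ : 0 < c₂) (hsum : c₁ + c₂ = 1) :
    -- no deterministic catalytic conversion
    ¬ DeterministicLOCC (shared (linkState θ) (catalyst c₁ c₂))
        (shared bellState (catalyst c₁ c₂)) ∧
    -- the optimal success probability
    IsGreatest (successProbabilities (shared (linkState θ) (catalyst c₁ c₂))
        (shared bellState (catalyst c₁ c₂))) (2 * Real.sin θ ^ 2) ∧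
    -- the success branch of the filter on `A`
    ((procrusteanFilter θ ⊗ₖ (1 : Matrix (Fin 2) (Fin 2) ℂ)) ⊗ₖ
        (1 : Matrix (Fin 2 × Fin 2) (Fin 2 × Fin 2) ℂ)).mulVec
          (shared (linkState θ) (catalyst c₁ c₂)) =
      ((√2 * Real.sin θ : ℝ) : ℂ) • shared bellState (catalyst c₁ c₂) ∧
    -- the filter is the success operator of a measurement on `A`, and is optimal
    ∃ (N : Matrix (Fin 2) (Fin 2) ℂ)
      (h : (procrusteanFilter θ).conjTranspose * procrusteanFilter θ +
        N.conjTranspose * N = 1),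
      (oneSidedFilter (procrusteanFilter θ) N h).SucceedsWith
        (shared (linkState θ) (catalyst c₁ c₂)) (shared bellState (catalyst c₁ c₂))
        (2 * Real.sin θ ^ 2) := by
  have hpi := Real.pi_pos
  have hcos : 0 < Real.cos θ := Real.cos_pos_of_mem_Ioo ⟨by linarith, by linarith⟩
  -- Rewritten as `2 cos²θ > 1`, this gives both `tan²θ ≤ 1`, so that the failure operator exists,
  -- and `2 sin²θ < 1`.
  have hcos2 : 0 < Real.cos (2 * θ) := Real.cos_pos_of_mem_Ioo ⟨by linarith, by linarith⟩
  rw [Real.cos_two_mul] at hcos2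
  have hsc := Real.sin_sq_add_cos_sq θ
  have htan : Real.tan θ ^ 2 ≤ 1 := by
    rw [Real.tan_eq_sin_div_cos, div_pow, div_le_one (by positivity)]
    linarith
  have hfilter := procrusteanFilter_mulVec θ c₁ c₂ hcos.ne'
  obtain ⟨N, hN⟩ := exists_failure_operator θ htan
  have hsucc := oneSidedFilter_succeedsWith _ N hN _ _ _ hfilter
  rw [mul_pow, Real.sq_sqrt (by norm_num)] at hsucc
  refine ⟨?_, ⟨⟨_, hsucc⟩, ?_⟩, hfilter, N, hN, hsucc⟩
  · rintro ⟨P, hP⟩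
    have := P.probability_le θ c₁ c₂ hc hc₂ () 1 (by rw [hP, Complex.ofReal_one, one_smul])
    linarith
  · rintro p ⟨P, hP⟩
    exact P.probability_le θ c₁ c₂ hc hc₂ true p hP
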